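/- Let $G=(V,\mathcal A)$ be a finite hypergraph all of whose hyperedges $\alpha\in\mathcal A$ are nonempty subsets of the finite set $V$ (parallel hyperedges are allowed), with potential functions $\phi_i:\{0,1\}\to\mathbb R_{\ge 0}$ for $i\in V$ and $\psi_\alpha:\{0,1\}^{\alpha}\to\mathbb R_{\ge 0}$ for $\alpha\in\mathcal A$. Suppose that the factorization $f(x)=\prod_{i\in V}\phi_i(x_i)\prod_{\alpha\in\mathcal A}\psi_\alpha(x_\alpha)$ is log-supermodular, i.e. $\psi_\alpha(x)\psi_\alpha(y)\le\psi_\alpha(x\wedge y)\psi_\alpha(x\vee y)$ for all $\alpha\in\mathcal A$ and $x,y\in\{0,1\}^\alpha$. Let $Z(G)=\sum_{x\in\{0,1\}^V}f(x)$ denote the partition function. For $k\ge 1$, let $\mathcal C^k(G)$ be the finite set of labelled $k$-covers of the factor graph of $G$ (the bipartite graph on $V\sqcup\mathcal A$ with an edge between $i$ and $\alpha$ whenever $i\in\alpha$): the graphs $H$ on $(V\sqcup\mathcal A)\times\{1,\dots,k\}$ for which the first projection is a graph homomorphism that maps the neighbourhood of each node bijectively onto the neighbourhood of its image. Each node of $H\in\mathcal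 C^k(G)$ carries the potential of the node of which it is a copy, which makes $H$ a graphical model with $k|V|$ binary variables, and $Z(H)$ denotes its partition function. Let $\mathcal T$ be the set of all nonnegative $\tau=((\tau_i)_{i\in V},(\tau_\alpha)_{\alpha\in\mathcal A})$, with $\tau_i$ a function on $\{0,1\}$ and $\tau_\alpha$ a function on $\{0,1\}^\alpha$, such that $\sum_{x_i}\tau_i(x_i)=1$ for all $i\in V$ and $\sum_{x_{\alpha\setminus i}}\tau_\alpha(x_\alpha)=\tau_i(x_i)$ for all $\alpha\in\mathcal A$, $i\in\alpha$ and $x_i\in\{0,1\}$. For $\tau\in\mathcal T$ let $$\log Z_{\mathrm B}(G,\tau)=\sum_{i\in V}\sum_{x_i}\tau_i(x_i)\log\phi_i(x_i)+\sum_{\alpha\in\mathcal A}\sum_{x_\alpha}\tau_\alpha(x_\alpha)\log\psi_\alpha(x_\alpha)-\sum_{i\in V}\sum_{x_i}\tau_i(x_i)\log\tau_i(x_i)-\sum_{\alpha\in\mathcal A}\sum_{x_\alpha}\tau_\alpha(x_\alpha)\log\frac{\tau_\alpha(x_\alpha)}{\prod_{i\in\alpha}\tau_i(x_i)},$$ where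 terms with coefficient $0$ are $0$, $\log 0=-\infty$ and $\exp(-\infty)=0$. Then the Bethe partition function $Z_{\mathrm B}(G)=\max_{\tau\in\mathcal T}Z_{\mathrm B}(G,\tau)$ exists (the maximum is attained), and $$Z_{\mathrm B}(G)=\lim_{k\to\infty}\left(\frac{1}{|\mathcal C^k(G)|}\sum_{H\in\mathcal C^k(G)}Z(H)\right)^{1/k};$$ in particular the limit exists. -/

import Mathlib

open Filter Topology

noncomputable section

/-- A function `f : {0,1}^ι → ℝ` is log-supermodular: `f x * f y ≤ f (x ∧ y) * f (x ∨ y)`.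
`{0,1}` is `Bool`, and `⊓`, `⊔` are the coordinatewise minimum and maximum. -/
def LogSupermodular {ι : Type*} (f : (ι → Bool) → ℝ) : Prop :=
  ∀ x y : ι → Bool, f x * f y ≤ f (x ⊓ y) * f (x ⊔ y)

/-- A binary graphical model over a hypergraph with vertices `V` and hyperedges `α : A`, the
hyperedge `α` being the vertex set `scope α`, with nonnegative potential functions
`φ i : {0,1} → ℝ` and `ψ α : {0,1}^α → ℝ`. -/
structure GraphicalModel (V A : Type*) where
  scope : A → Finset V
  φ : V → Bool → ℝ
  ψ : (α : A) → (scope α → Bool) → ℝ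
  φ_nonneg : ∀ i s, 0 ≤ φ i s
  ψ_nonneg : ∀ α y, 0 ≤ ψ α y

/-- The map `h` exhibits the graph `H` as a cover of the graph `G`: it is a graph homomorphism
which maps the neighbourhood of each `w` bijectively to the neighbourhood of `h w`. -/
structure IsGraphCover {W N : Type*} (H : SimpleGraph W) (G : SimpleGraph N) (h : W → N) :
    Prop where
  map_adj : ∀ {u w : W}, H.Adj u w → G.Adj (h u) (h w)
  bijOn : ∀ w : W, Set.BijOn h (H.neighborSet w) (G.neighborSet (h w))

/-- The set `C^k(G)` of (labelled) `k`-covers of a graph `G`: the `k` copies of a node `v` are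
`(v, 0), …, (v, k - 1)`, and the covering map is the first projection. -/
def KCover {N : Type*} (G : SimpleGraph N) (k : ℕ) : Type _ :=
  {H : SimpleGraph (N × Fin k) // IsGraphCover H G Prod.fst}

instance {N : Type*} [Finite N] (G : SimpleGraph N) (k : ℕ) : Finite (KCover G k) :=
  inferInstanceAs (Finite {H : SimpleGraph (N × Fin k) // IsGraphCover H G Prod.fst})

instance {N : Type*} [Finite N] (G : SimpleGraph N) (k : ℕ) : Fintype (KCover G k) :=
  Fintype.ofFinite _

namespace GraphicalModel

variable {V A : Type*}

/-- The factorization is log-supermodular: every `ψ α` is. -/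
def IsLogSupermodular (G : GraphicalModel V A) : Prop :=
  ∀ α, LogSupermodular (G.ψ α)

/-- The factor graph: variable nodes `inl i`, factor nodes `inr α`, and an edge between
`inl i` and `inr α` whenever `i ∈ α`. -/
def factorGraph (G : GraphicalModel V A) : SimpleGraph (V ⊕ A) where
  Adj
    | .inl i, .inr α => i ∈ G.scope α
    | .inr α, .inl i => i ∈ G.scope α
    | _, _ => False
  symm := ⟨by rintro (i | α) (j | β) h <;> exact h⟩
  loopless := ⟨by rintro (i | α) h <;> exact h⟩

section Partition

variable [Fintype V] [Fintype A]

/-- `f(x) = ∏ i, φ i (x i) * ∏ α, ψ α (x_α)`. -/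
def f (G : GraphicalModel V A) (x : V → Bool) : ℝ :=
  (∏ i, G.φ i (x i)) * ∏ α, G.ψ α (fun i => x i)

/-- The partition function `Z(G) = ∑ x, f(x)`. -/
def Z [DecidableEq V] (G : GraphicalModel V A) : ℝ :=
  ∑ x : V → Bool, G.f x

end Partition

section Cover

variable {k : ℕ} (G : GraphicalModel V A) (H : KCover G.factorGraph k)

theorem exists_copy (β : A × Fin k) (i : G.scope β.1) :
    ∃ a : Fin k, H.1.Adj (.inr β.1, β.2) (.inl i.1, a) := by
  obtain ⟨⟨w, a⟩, hw, hwi⟩ := (H.2.bijOn (.inr β.1, β.2)).surjOn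
    (show (.inl i.1 : V ⊕ A) ∈ G.factorGraph.neighborSet (.inr β.1) from i.2)
  obtain rfl : w = .inl i.1 := hwi
  exact ⟨a, hw⟩

/-- The label of the (unique) copy of the variable `i ∈ α` adjacent in `H` to the copy
`β = (α, b)` of the factor `α`. -/
def copy (β : A × Fin k) (i : G.scope β.1) : Fin k :=
  (G.exists_copy H β i).choose

theorem adj_copy (β : A × Fin k) (i : G.scope β.1) :
    H.1.Adj (.inr β.1, β.2) (.inl i.1, G.copy H β i) :=
  (G.exists_copy H β i).choose_spec

theorem copy_unique (β : A × Fin k) (i : G.scope β.1) (a : Fin k)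
    (h : H.1.Adj (.inr β.1, β.2) (.inl i.1, a)) : a = G.copy H β i :=
  congrArg Prod.snd ((H.2.bijOn (.inr β.1, β.2)).injOn h (G.adj_copy H β i) rfl)

open Classical in
/-- The graphical model on a `k`-cover `H` of the factor graph of `G`: each node of `H` carries
the potential of the node of which it is a copy. -/
def cover [Fintype V] : GraphicalModel (V × Fin k) (A × Fin k) where
  scope β := Finset.univ.filter fun p => H.1.Adj (.inr β.1, β.2) (.inl p.1, p.2)
  φ p s := G.φ p.1 s
  ψ β y := G.ψ β.1 fun i => y ⟨(i.1, G.copy H β i), by simpa using G.adj_copy H β i⟩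
  φ_nonneg p s := G.φ_nonneg p.1 s
  ψ_nonneg β _ := G.ψ_nonneg β.1 _

end Cover

section Bethe

/-- Candidate pseudomarginals `τ = ((τ_i)_i, (τ_α)_α)`. -/
abbrev Pseudomarginal (G : GraphicalModel V A) : Type _ :=
  (V → Bool → ℝ) × ((α : A) → (G.scope α → Bool) → ℝ)

variable [DecidableEq V]

/-- The local marginal polytope. -/
def localPolytope (G : GraphicalModel V A) : Set G.Pseudomarginal :=
  {τ | (∀ i s, 0 ≤ τ.1 i s) ∧ (∀ α y, 0 ≤ τ.2 α y) ∧
    (∀ (α : A) (i : G.scope α) (s : Bool),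
      ∑ y : G.scope α → Bool with y i = s, τ.2 α y = τ.1 i s) ∧
    ∀ i, ∑ s, τ.1 i s = 1}

variable [Fintype V] [Fintype A]

/-- The entropy part of the Bethe approximation (`0 * log 0 = 0`):
`- ∑_i ∑_{x_i} τ_i log τ_i - ∑_α ∑_{x_α} τ_α log (τ_α / ∏_{i ∈ α} τ_i)`. -/
def betheEntropy (G : GraphicalModel V A) (τ : G.Pseudomarginal) : ℝ :=
  - (∑ i, ∑ s, τ.1 i s * Real.log (τ.1 i s))
  - ∑ α, ∑ y : G.scope α → Bool,
      τ.2 α y * Real.log (τ.2 α y / ∏ i : G.scope α, τ.1 i (y i))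

/-- The Bethe approximation `Z_B(G, τ)`. The energy terms `τ log φ`, `τ log ψ` are
exponentiated to `φ ^ τ`, `ψ ^ τ`, so that vanishing potentials are covered, with the usual
conventions `exp (t log 0) = 0` for `t > 0` and `exp (0 log 0) = 1`. For positive potentials see
`log_betheApprox`. -/
def betheApprox (G : GraphicalModel V A) (τ : G.Pseudomarginal) : ℝ :=
  (∏ i, ∏ s, G.φ i s ^ τ.1 i s) * (∏ α, ∏ y : G.scope α → Bool, G.ψ α y ^ τ.2 α y) *
    Real.exp (G.betheEntropy τ)

/-- The usual logarithmic form of the Bethe approximation, for positive potentials. -/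
theorem log_betheApprox (G : GraphicalModel V A) (hφ : ∀ i s, 0 < G.φ i s)
    (hψ : ∀ α y, 0 < G.ψ α y) (τ : G.Pseudomarginal) :
    Real.log (G.betheApprox τ) =
      ∑ i, ∑ s, τ.1 i s * Real.log (G.φ i s)
      + ∑ α, ∑ y : G.scope α → Bool, τ.2 α y * Real.log (G.ψ α y)
      - ∑ i, ∑ s, τ.1 i s * Real.log (τ.1 i s)
      - ∑ α, ∑ y : G.scope α → Bool,
          τ.2 α y * Real.log (τ.2 α y / ∏ i : G.scope α, τ.1 i (y i)) := by
  have h1 : ∀ i s, (G.φ i s ^ τ.1 i s) ≠ 0 := fun i s => (Real.rpow_pos_of_pos (hφ i s) _).ne'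
  have h2 : ∀ α y, (G.ψ α y ^ τ.2 α y) ≠ 0 := fun α y => (Real.rpow_pos_of_pos (hψ α y) _).ne'
  have h3 : (∏ i, ∏ s, G.φ i s ^ τ.1 i s) ≠ 0 :=
    Finset.prod_ne_zero_iff.2 fun i _ => Finset.prod_ne_zero_iff.2 fun s _ => h1 i s
  have h4 : (∏ α, ∏ y : G.scope α → Bool, G.ψ α y ^ τ.2 α y) ≠ 0 :=
    Finset.prod_ne_zero_iff.2 fun i _ => Finset.prod_ne_zero_iff.2 fun s _ => h2 i s
  rw [betheApprox, Real.log_mul (mul_ne_zero h3 h4) (Real.exp_pos _).ne', Real.log_mul h3 h4,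
    Real.log_exp, Real.log_prod fun i _ => Finset.prod_ne_zero_iff.2 fun s _ => h1 i s,
    Real.log_prod fun i _ => Finset.prod_ne_zero_iff.2 fun s _ => h2 i s]
  simp_rw [Real.log_prod fun s (_ : s ∈ Finset.univ) => h1 _ s,
    Real.log_prod fun s (_ : s ∈ Finset.univ) => h2 _ s, Real.log_rpow (hφ _ _),
    Real.log_rpow (hψ _ _), betheEntropy]
  ring

/-- The Bethe partition function `Z_B(G) = max_{τ ∈ T} Z_B(G, τ)`. -/
def betheZ (G : GraphicalModel V A) : ℝ :=
  sSup (G.betheApprox '' G.localPolytope)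

end Bethe

end GraphicalModel

end

/-! A `k`-cover amounts to one permutation of `Fin k` per edge of the factor graph (`coverEquiv`),
so under the average over covers these permutations are independent and uniform. Label each copy of
a variable by its value and each copy of a factor by the configuration it sees. Given the variable
labels, the probability of a factor labelling depends only on counts: it is the product over the
edges `(i, α)` of the inverse multinomial coefficient at `i` if the counts at `i` and `α` agree, and
zero otherwise (`average_Z_cover`).

Grouping labellings by their counts `t` leaves the potentials times a product of multinomial
coefficients in which those of the edges are inverted (`typeWeight_eq`). A multinomial coefficient
is the exponential of `k` times an entropy up to a polynomial factor, and the signs match those of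
the Bethe entropy on the local polytope. Hence each group weighs `Z_B(G, t/k) ^ k` up to a
polynomial factor (`typeWeight_le`, `betheApprox_pow_le`). There are only polynomially many groups,
so the upper bound follows on taking `k`-th roots.

The lower bound needs, for every large `k`, admissible points `t/k` near a maximizer `τ` that avoid
the zeros of the potentials. Rational approximation alone would only promise this for suitable
multiples `k`. Log-supermodularity supplies an integral point with nonzero potentials
(`exists_configuration_ne_zero`), and adding multiples of it repairs the rounding for all large `k`
(`exists_nat_approximation`). -/

noncomputable section

/-! ### Sequences and permutations with prescribed value counts -/

section Counting

variable {k : ℕ} {Y : Type*} [DecidableEq Y]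

/-- The number of times that the sequence `x` takes the value `y`. -/
def valueCount (x : Fin k → Y) (y : Y) : ℕ :=
  (Finset.univ.filter fun b => x b = y).card

theorem sum_valueCount [Fintype Y] (x : Fin k → Y) : ∑ y, valueCount x y = k := by
  have h := Finset.card_eq_sum_card_fiberwise (f := x) (s := Finset.univ) (t := Finset.univ)
    (by simp)
  simpa [valueCount] using h.symm

theorem valueCount_le (x : Fin k → Y) (y : Y) : valueCount x y ≤ k := by
  simpa [valueCount] using Finset.card_filter_le (Finset.univ : Finset (Fin k)) (fun b => x b = y)

theorem valueCount_comp_perm (x : Fin k → Y) (σ : Equiv.Perm (Fin k)) :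
    valueCount (x ∘ σ) = valueCount x := by
  funext y
  refine Finset.card_bij (fun b _ => σ b) (by simp) (fun _ _ _ _ h => σ.injective h) ?_
  intro b hb
  exact ⟨σ.symm b, by simpa using hb, by simp⟩

theorem valueCount_comp [Fintype Y] {S : Type*} [DecidableEq S] (g : Y → S) (x : Fin k → Y)
    (s : S) : valueCount (fun b => g (x b)) s = ∑ y with g y = s, valueCount x y := by
  unfold valueCount
  rw [Finset.card_eq_sum_card_fiberwise (f := x) (t := Finset.univ.filter fun y => g y = s)]
  · refine Finset.sum_congr rfl fun y hy => ?_
    congr 1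
    ext b
    simp only [Finset.mem_filter, Finset.mem_univ, true_and] at hy ⊢
    exact ⟨fun h => h.2, fun h => ⟨by rw [h, hy], h⟩⟩
  · intro b hb
    simpa using hb

theorem prod_comp_eq_prod_pow_valueCount [Fintype Y] (g : Y → ℝ) (x : Fin k → Y) :
    ∏ b, g (x b) = ∏ y, g y ^ valueCount x y := by
  rw [← Finset.prod_fiberwise_of_maps_to (s := Finset.univ) (t := Finset.univ) (g := x) (by simp)]
  refine Finset.prod_congr rfl fun y _ => ?_
  rw [Finset.prod_congr rfl (g := fun _ => g y), Finset.prod_const, valueCount]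
  intro b hb
  rw [(Finset.mem_filter.1 hb).2]

theorem exists_comp_perm_eq {x y : Fin k → Y} (h : valueCount x = valueCount y) :
    ∃ σ : Equiv.Perm (Fin k), x ∘ σ = y := by
  have e : ∀ c, Nonempty ({b // y b = c} ≃ {b // x b = c}) := fun c =>
    ⟨Fintype.equivOfCardEq (by
      rw [Fintype.card_subtype, Fintype.card_subtype]
      exact (congrFun h c).symm)⟩
  exact ⟨Equiv.ofFiberEquiv fun c => (e c).some, funext fun b => Equiv.ofFiberEquiv_map _ b⟩

/-- The solutions form a coset of the stabilizer of `x`, which permutes each level set of `x`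
separately; there is a solution exactly when the level sets have matching sizes. -/
theorem card_perm_comp_eq [Fintype Y] (x y : Fin k → Y) :
    (Finset.univ.filter fun σ : Equiv.Perm (Fin k) => x ∘ σ = y).card =
      if valueCount x = valueCount y then ∏ s, (valueCount x s).factorial else 0 := by
  split_ifs with h
  · obtain ⟨σ₀, rfl⟩ := exists_comp_perm_eq h
    have h1 := DomMulAct.stabilizer_card x
    simp only [Fintype.card_subtype] at h1
    unfold valueCount
    rw [← h1]
    refine Finset.card_bij (fun σ _ => σ * σ₀⁻¹) ?_ ?_ ?_
    · intro σ hσ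
      simp only [Finset.mem_filter, Finset.mem_univ, true_and] at hσ ⊢
      rw [Equiv.Perm.coe_mul, ← Function.comp_assoc, hσ]
      funext b
      simp
    · intro σ _ σ' _ h
      exact mul_right_cancel h
    · intro σ hσ
      refine ⟨σ * σ₀, ?_, by simp⟩
      simp only [Finset.mem_filter, Finset.mem_univ, true_and] at hσ ⊢
      rw [Equiv.Perm.coe_mul, ← Function.comp_assoc, hσ]
  · rw [Finset.card_eq_zero, Finset.filter_eq_empty_iff]
    rintro σ - rfl
    exact h (valueCount_comp_perm x σ).symm

theorem exists_valueCount_eq [Fintype Y] {c : Y → ℕ} (hc : ∑ y, c y = k) :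
    ∃ x : Fin k → Y, valueCount x = c := by
  have e : (Σ y, Fin (c y)) ≃ Fin k := Fintype.equivFinOfCardEq (by simpa using hc)
  refine ⟨fun b => (e.symm b).1, funext fun y => ?_⟩
  have : valueCount (fun b => (e.symm b).1) y =
      (Finset.univ.filter fun p : Σ y, Fin (c y) => p.1 = y).card := by
    refine Finset.card_bij (fun b _ => e.symm b) (by simp) (fun _ _ _ _ h => e.symm.injective h) ?_
    intro p hp
    exact ⟨e p, by simpa using hp, by simp⟩
  rw [this]
  have h2 : (Finset.univ.filter fun p : Σ y, Fin (c y) => p.1 = y) =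
      Finset.univ.map (Function.Embedding.sigmaMk (β := fun y => Fin (c y)) y) := by
    ext ⟨y', j⟩
    simp only [Finset.mem_filter, Finset.mem_univ, true_and, Finset.mem_map,
      Function.Embedding.sigmaMk_apply]
    constructor
    · rintro rfl
      exact ⟨j, rfl⟩
    · rintro ⟨a, h⟩
      exact (congrArg Sigma.fst h).symm
  rw [h2]
  simp

/-- Orbit counting: `σ ↦ x ∘ σ` maps all `k!` permutations onto the sequences with these counts,
with fibres of equal size. -/
theorem card_valueCount_eq_mul [Fintype Y] {c : Y → ℕ} (hc : ∑ y, c y = k) :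
    (Finset.univ.filter fun x : Fin k → Y => valueCount x = c).card * ∏ y, (c y).factorial =
      k.factorial := by
  obtain ⟨x, rfl⟩ := exists_valueCount_eq hc
  have h := Finset.card_eq_sum_card_fiberwise (f := fun σ : Equiv.Perm (Fin k) => x ∘ σ)
    (s := Finset.univ) (t := Finset.univ.filter fun z : Fin k → Y => valueCount z = valueCount x)
    (by intro σ _; simpa using valueCount_comp_perm x σ)
  rw [Finset.card_univ, Fintype.card_perm, Fintype.card_fin] at h
  rw [h, Finset.sum_congr rfl (g := fun _ => ∏ y, (valueCount x y).factorial), Finset.sum_const,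
    smul_eq_mul]
  intro z hz
  rw [card_perm_comp_eq, if_pos (Finset.mem_filter.1 hz).2.symm]

end Counting

/-! ### Multinomial coefficients and Shannon entropy -/

section Multinomial

/-- The ratio of `n!` to `(n / e) ^ n`. -/
def factorialRatio (n : ℕ) : ℝ := n.factorial * Real.exp n / (n : ℝ) ^ n

theorem natCast_pow_self_pos (n : ℕ) : 0 < (n : ℝ) ^ n := by
  rcases Nat.eq_zero_or_pos n with rfl | h
  · simp
  · positivity

/-- The number `n ^ n / n!` is a single term of the series of `exp n`. -/
theorem one_le_factorialRatio (n : ℕ) : 1 ≤ factorialRatio n := by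
  rw [factorialRatio, one_le_div (natCast_pow_self_pos n)]
  have h := Real.pow_div_factorial_le_exp (n : ℝ) (Nat.cast_nonneg n) n
  rwa [div_le_iff₀' (by positivity)] at h

/-- This says that `factorialRatio n / n` is nonincreasing, which comes down to `e ≤ (1 + 1/n) ^ (n
+ 1)`. It gives a linear upper bound, a weak Stirling estimate that suffices because polynomial
factors disappear under `k`-th roots. -/
theorem factorialRatio_succ_mul_le {n : ℕ} (hn : 1 ≤ n) :
    factorialRatio (n + 1) * n ≤ factorialRatio n * (n + 1) := by
  have hn0 : (0 : ℝ) < n := by exact_mod_cast hn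
  have key : Real.exp 1 * (n : ℝ) ^ (n + 1) ≤ ((n : ℝ) + 1) ^ (n + 1) := by
    -- The inequality `log u ≥ 1 - 1/u` at `u = (n + 1)/n`, where the right side is `1/(n + 1)`.
    have h1 := Real.one_sub_inv_le_log_of_pos (show 0 < ((n : ℝ) + 1) / n by positivity)
    have h2 : 1 ≤ ((n : ℝ) + 1) * Real.log (((n : ℝ) + 1) / n) := by
      calc (1 : ℝ) = ((n : ℝ) + 1) * (1 - (((n : ℝ) + 1) / n)⁻¹) := by field_simp; ring
        _ ≤ _ := by gcongr
    have h3 : Real.exp 1 ≤ (((n : ℝ) + 1) / n) ^ (n + 1) := by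
      rw [← Real.exp_log (show 0 < (((n : ℝ) + 1) / n) ^ (n + 1) by positivity), Real.exp_le_exp,
        Real.log_pow]
      push_cast
      exact h2
    rwa [div_pow, le_div_iff₀ (by positivity)] at h3
  unfold factorialRatio
  rw [div_mul_eq_mul_div, div_mul_eq_mul_div, div_le_div_iff₀ (natCast_pow_self_pos _)
    (natCast_pow_self_pos _)]
  rw [Nat.factorial_succ]
  push_cast
  rw [Real.exp_add]
  calc _ = (((n : ℝ) + 1) * n.factorial * Real.exp n) * (Real.exp 1 * (n : ℝ) ^ (n + 1)) := by ring
    _ ≤ (((n : ℝ) + 1) * n.factorial * Real.exp n) * ((n : ℝ) + 1) ^ (n + 1) := by gcongr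
    _ = _ := by ring

theorem factorialRatio_le_of_pos {n : ℕ} (hn : 1 ≤ n) : factorialRatio n ≤ Real.exp 1 * n := by
  induction n, hn using Nat.le_induction with
  | base => simp [factorialRatio]
  | succ n hn ih =>
    have hn0 : (0 : ℝ) < n := by exact_mod_cast hn
    have h := factorialRatio_succ_mul_le hn
    push_cast
    refine le_of_mul_le_mul_right (h.trans ?_) hn0
    calc _ ≤ Real.exp 1 * n * (n + 1) := by gcongr
      _ = _ := by ring

theorem factorialRatio_le {n k : ℕ} (h : n ≤ k) : factorialRatio n ≤ 3 * (k + 1) := by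
  have hnk : (n : ℝ) ≤ k := by exact_mod_cast h
  rcases Nat.eq_zero_or_pos n with rfl | hn
  · simp [factorialRatio]
    linarith
  · have h1 := factorialRatio_le_of_pos hn
    have h2 : Real.exp 1 ≤ 3 := by linarith [Real.exp_one_lt_d9]
    nlinarith

variable {Y : Type*} [Fintype Y]

/-- The multinomial coefficient `k! / ∏ y, (c y)!`. -/
def multiCoeff (k : ℕ) (c : Y → ℕ) : ℝ := k.factorial / ∏ y, ((c y).factorial : ℝ)

theorem card_valueCount_eq [DecidableEq Y] {k : ℕ} {c : Y → ℕ} (hc : ∑ y, c y = k) :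
    ((Finset.univ.filter fun x : Fin k → Y => valueCount x = c).card : ℝ) = multiCoeff k c := by
  rw [multiCoeff, eq_div_iff (Finset.prod_ne_zero_iff.2 fun y _ => by positivity)]
  exact_mod_cast card_valueCount_eq_mul hc

/-- The Shannon entropy of `p`. -/
def shannonEntropy (p : Y → ℝ) : ℝ := ∑ y, Real.negMulLog (p y)

theorem exp_mul_shannonEntropy {k : ℕ} (hk : k ≠ 0) {c : Y → ℕ} (hc : ∑ y, c y = k) :
    Real.exp (k * shannonEntropy fun y => (c y : ℝ) / k) =
      (k : ℝ) ^ k / ∏ y, (c y : ℝ) ^ c y := by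
  have hk0 : (0 : ℝ) < k := by exact_mod_cast Nat.pos_of_ne_zero hk
  rw [shannonEntropy, Finset.mul_sum, Real.exp_sum]
  have h : ∀ y, Real.exp (k * Real.negMulLog ((c y : ℝ) / k)) =
      (k : ℝ) ^ c y / (c y : ℝ) ^ c y := by
    intro y
    rcases Nat.eq_zero_or_pos (c y) with h | h
    · simp [h]
    · have hc0 : (0 : ℝ) < c y := by exact_mod_cast h
      have e : (k : ℝ) * Real.negMulLog ((c y : ℝ) / k) = c y * Real.log (k / c y) := by
        rw [Real.negMulLog, ← inv_div (k : ℝ) (c y : ℝ), Real.log_inv]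
        field_simp
      rw [e, ← Real.log_pow, Real.exp_log (by positivity), div_pow]
  simp_rw [h, Finset.prod_div_distrib, Finset.prod_pow_eq_pow_sum, hc]

theorem multiCoeff_eq {k : ℕ} (hk : k ≠ 0) {c : Y → ℕ} (hc : ∑ y, c y = k) :
    multiCoeff k c = Real.exp (k * shannonEntropy fun y => (c y : ℝ) / k) *
      (factorialRatio k / ∏ y, factorialRatio (c y)) := by
  have h : ∀ n : ℕ, (n.factorial : ℝ) = factorialRatio n * (n : ℝ) ^ n / Real.exp n := by
    intro n
    have := (natCast_pow_self_pos n).ne'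
    unfold factorialRatio
    field_simp
  have h2 : ∏ y, Real.exp (c y) = Real.exp k := by
    rw [← Real.exp_sum, ← hc]
    push_cast
    rfl
  rw [exp_mul_shannonEntropy hk hc, multiCoeff]
  simp_rw [h, Finset.prod_div_distrib, Finset.prod_mul_distrib, h2]
  have h3 : ∏ y, factorialRatio (c y) ≠ 0 := Finset.prod_ne_zero_iff.2 fun y _ =>
    (zero_lt_one.trans_le (one_le_factorialRatio _)).ne'
  have h4 : ∏ y, (c y : ℝ) ^ c y ≠ 0 := Finset.prod_ne_zero_iff.2 fun y _ =>
    (natCast_pow_self_pos _).ne'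
  have h5 := (Real.exp_pos (k : ℝ)).ne'
  field_simp

/-- `a` and `b` are positive and agree up to the factor `B`. -/
structure AgreeUpTo (B a b : ℝ) : Prop where
  pos_left : 0 < a
  pos_right : 0 < b
  le : a ≤ B * b
  ge : b ≤ B * a

namespace AgreeUpTo

variable {B C a b c d : ℝ}

theorem mul (h : AgreeUpTo B a b) (h' : AgreeUpTo C c d) :
    AgreeUpTo (B * C) (a * c) (b * d) where
  pos_left := mul_pos h.pos_left h'.pos_left
  pos_right := mul_pos h.pos_right h'.pos_right
  le := (mul_le_mul h.le h'.le h'.pos_left.le (h.pos_left.le.trans h.le)).trans_eq (by ring)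
  ge := (mul_le_mul h.ge h'.ge h'.pos_right.le (h.pos_right.le.trans h.ge)).trans_eq (by ring)

theorem inv (h : AgreeUpTo B a b) : AgreeUpTo B a⁻¹ b⁻¹ where
  pos_left := inv_pos.2 h.pos_left
  pos_right := inv_pos.2 h.pos_right
  le := by
    rw [← div_eq_mul_inv, inv_le_iff_one_le_mul₀ h.pos_left, div_mul_eq_mul_div,
      one_le_div h.pos_right]
    exact h.ge
  ge := by
    rw [← div_eq_mul_inv, inv_le_iff_one_le_mul₀ h.pos_right, div_mul_eq_mul_div,
      one_le_div h.pos_left]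
    exact h.le

theorem prod {ι : Type*} [Fintype ι] {B a b : ι → ℝ} (h : ∀ i, AgreeUpTo (B i) (a i) (b i)) :
    AgreeUpTo (∏ i, B i) (∏ i, a i) (∏ i, b i) where
  pos_left := Finset.prod_pos fun i _ => (h i).pos_left
  pos_right := Finset.prod_pos fun i _ => (h i).pos_right
  le := by
    rw [← Finset.prod_mul_distrib]
    exact Finset.prod_le_prod (fun i _ => (h i).pos_left.le) fun i _ => (h i).le
  ge := by
    rw [← Finset.prod_mul_distrib]
    exact Finset.prod_le_prod (fun i _ => (h i).pos_right.le) fun i _ => (h i).ge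

end AgreeUpTo

/-- By `multiCoeff_eq` the quotient of the two sides is a quotient of factorial ratios, one for `k`
and one for each `y`, all lying between `1` and `3 * (k + 1)`. -/
theorem agreeUpTo_multiCoeff {k : ℕ} (hk : k ≠ 0) {c : Y → ℕ} (hc : ∑ y, c y = k) :
    AgreeUpTo ((3 * ((k : ℝ) + 1)) ^ (Fintype.card Y + 1)) (multiCoeff k c)
      (Real.exp (k * shannonEntropy fun y => (c y : ℝ) / k)) := by
  have hB : 1 ≤ 3 * ((k : ℝ) + 1) := by linarith [(Nat.cast_nonneg k : (0 : ℝ) ≤ k)]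
  have hk1 := one_le_factorialRatio k
  have hk2 := factorialRatio_le (le_refl k)
  have hp1 : 1 ≤ ∏ y, factorialRatio (c y) := by
    simpa using Finset.prod_le_prod (s := Finset.univ) (f := fun _ : Y => (1 : ℝ))
      (fun _ _ => zero_le_one) fun y _ => one_le_factorialRatio (c y)
  have hp2 : ∏ y, factorialRatio (c y) ≤ (3 * ((k : ℝ) + 1)) ^ Fintype.card Y := by
    rw [← Finset.card_univ, ← Finset.prod_const]
    refine Finset.prod_le_prod (fun y _ => zero_le_one.trans (one_le_factorialRatio _)) fun y _ => ?_
    exact factorialRatio_le (hc ▸ Finset.single_le_sum (fun _ _ => Nat.zero_le _)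
      (Finset.mem_univ y))
  rw [multiCoeff_eq hk hc]
  set E := Real.exp (k * shannonEntropy fun y => (c y : ℝ) / k)
  have hE : 0 < E := Real.exp_pos _
  set P := ∏ y, factorialRatio (c y)
  set B := 3 * ((k : ℝ) + 1)
  have hP0 : 0 < P := zero_lt_one.trans_le hp1
  have hr0 : 0 < factorialRatio k := zero_lt_one.trans_le hk1
  refine ⟨by positivity, hE, ?_, ?_⟩
  · rw [mul_comm]
    refine mul_le_mul_of_nonneg_right ?_ hE.le
    calc factorialRatio k / P ≤ factorialRatio k := div_le_self hr0.le hp1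
      _ ≤ B := hk2
      _ ≤ B ^ (Fintype.card Y + 1) := le_self_pow₀ hB (Nat.succ_ne_zero _)
  · have : 1 ≤ B ^ (Fintype.card Y + 1) * (factorialRatio k / P) := by
      rw [← mul_div_assoc, one_le_div hP0]
      calc P ≤ B ^ Fintype.card Y := hp2
        _ ≤ B ^ (Fintype.card Y + 1) := pow_le_pow_right₀ hB (Nat.le_succ _)
        _ ≤ _ := le_mul_of_one_le_right (by positivity) hk1
    nlinarith

end Multinomial

/-! ### Covers as families of permutations -/

/-- The summand sees `σ` only through the configurations `y b`. The coordinates of `σ` are chosen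
independently, so the number of families producing a given `y` is a product of the counts in
`card_perm_comp_eq`. -/
theorem sum_perm_family {k : ℕ} {ι : Type*} [Fintype ι] [DecidableEq ι] (x : ι → Fin k → Bool)
    (Φ : (Fin k → ι → Bool) → ℝ) :
    ∑ σ : ι → Equiv.Perm (Fin k), Φ (fun b i => x i (σ i b)) =
      ∑ y : Fin k → ι → Bool, Φ y * ∏ i, if valueCount (x i) = valueCount (fun b => y b i)
        then ∏ s, ((valueCount (x i) s).factorial : ℝ) else 0 := by
  rw [← Finset.sum_fiberwise_of_maps_to (s := Finset.univ) (t := Finset.univ)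
    (g := fun (σ : ι → Equiv.Perm (Fin k)) b i => x i (σ i b)) (by simp)]
  refine Finset.sum_congr rfl fun y _ => ?_
  rw [Finset.sum_congr rfl (g := fun _ => Φ y)
    (by intro σ hσ; rw [(Finset.mem_filter.1 hσ).2]), Finset.sum_const, nsmul_eq_mul, mul_comm]
  congr 1
  have h : (Finset.univ.filter fun σ : ι → Equiv.Perm (Fin k) => (fun b i => x i (σ i b)) = y) =
      Fintype.piFinset fun i => Finset.univ.filter fun σ : Equiv.Perm (Fin k) =>
        x i ∘ σ = fun b => y b i := by
    ext σ
    simp only [Finset.mem_filter, Finset.mem_univ, true_and, Fintype.mem_piFinset, funext_iff,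
      Function.comp_apply]
    exact forall_comm
  rw [h, Fintype.card_piFinset]
  push_cast
  refine Finset.prod_congr rfl fun i _ => ?_
  rw [card_perm_comp_eq]
  split_ifs <;> simp

namespace GraphicalModel

variable {V A : Type*} {k : ℕ} (G : GraphicalModel V A)

section CoverEquiv

theorem cover_adj_iff (H : KCover G.factorGraph k) (α : A) (b a : Fin k) (i : V) :
    H.1.Adj (.inr α, b) (.inl i, a) ↔ ∃ h : i ∈ G.scope α, G.copy H (α, b) ⟨i, h⟩ = a := by
  constructor
  · intro h
    have hi : i ∈ G.scope α := H.2.map_adj h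
    exact ⟨hi, (G.copy_unique H (α, b) ⟨i, hi⟩ a h).symm⟩
  · rintro ⟨h, rfl⟩
    exact G.adj_copy H (α, b) ⟨i, h⟩

/-- This is local bijectivity at the variable nodes; the function `copy` itself only relies on local
bijectivity at the factor nodes. -/
theorem copy_injective (H : KCover G.factorGraph k) (α : A) (i : G.scope α) :
    Function.Injective fun b => G.copy H (α, b) i := by
  intro b b' h
  have h1 := (G.adj_copy H (α, b) i).symm
  have h2 := (G.adj_copy H (α, b') i).symm
  simp only at h
  rw [← h] at h2
  exact congrArg Prod.snd ((H.2.bijOn _).injOn h1 h2 rfl)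

/-- The permutation of the copies belonging to the edge between `i` and `α`. -/
def coverPerm (H : KCover G.factorGraph k) (α : A) (i : G.scope α) : Equiv.Perm (Fin k) :=
  Equiv.ofBijective _ (Finite.injective_iff_bijective.1 (G.copy_injective H α i))

/-- The graph on the copies determined by a family of permutations. -/
def permGraph (σ : ∀ α, G.scope α → Equiv.Perm (Fin k)) : SimpleGraph ((V ⊕ A) × Fin k) where
  Adj
    | (.inl i, a), (.inr α, b) => ∃ h : i ∈ G.scope α, σ α ⟨i, h⟩ b = a
    | (.inr α, b), (.inl i, a) => ∃ h : i ∈ G.scope α, σ α ⟨i, h⟩ b = a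
    | _, _ => False
  symm := ⟨by rintro ⟨i | α, a⟩ ⟨j | β, b⟩ h <;> exact h⟩
  loopless := ⟨by rintro ⟨i | α, a⟩ h <;> exact h⟩

theorem isGraphCover_permGraph (σ : ∀ α, G.scope α → Equiv.Perm (Fin k)) :
    IsGraphCover (G.permGraph σ) G.factorGraph Prod.fst := by
  have hmap : ∀ {u w : (V ⊕ A) × Fin k}, (G.permGraph σ).Adj u w →
      G.factorGraph.Adj u.1 w.1 := by
    rintro ⟨i | α, a⟩ ⟨j | β, b⟩ h
    · exact h
    · exact h.1
    · exact h.1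
    · exact h
  refine ⟨hmap, fun w => ⟨fun u hu => hmap hu, ?_, ?_⟩⟩
  · obtain ⟨i | α, a⟩ := w
    · rintro ⟨j | β, b⟩ hb ⟨j' | β', b'⟩ hb' h
      · exact hb.elim
      · exact hb.elim
      · exact hb'.elim
      · obtain rfl : β = β' := Sum.inr_injective h
        obtain ⟨h1, h2⟩ := hb
        obtain ⟨h1', h2'⟩ := hb'
        rw [(σ β ⟨i, h1⟩).injective (h2.trans h2'.symm)]
    · rintro ⟨j | β, b⟩ hb ⟨j' | β', b'⟩ hb' h
      · obtain rfl : j = j' := Sum.inl_injective h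
        obtain ⟨h1, h2⟩ := hb
        obtain ⟨h1', h2'⟩ := hb'
        rw [h2.symm.trans h2']
      · exact hb'.elim
      · exact hb.elim
      · exact hb.elim
  · obtain ⟨i | α, a⟩ := w
    · rintro (j | β) hj
      · exact hj.elim
      · exact ⟨(.inr β, (σ β ⟨i, hj⟩).symm a), ⟨hj, by simp⟩, rfl⟩
    · rintro (j | β) hj
      · exact ⟨(.inl j, σ α ⟨j, hj⟩ a), ⟨hj, rfl⟩, rfl⟩
      · exact hj.elim

theorem coverPerm_bijective :
    Function.Bijective (G.coverPerm : KCover G.factorGraph k → _) := by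
  constructor
  · intro H H' h
    have hc : ∀ α (i : G.scope α) b, G.copy H (α, b) i = G.copy H' (α, b) i := fun α i b =>
      congrArg (fun σ : Equiv.Perm (Fin k) => σ b) (congrFun (congrFun h α) i)
    have hadj : ∀ α b i a, H.1.Adj (.inr α, b) (.inl i, a) ↔ H'.1.Adj (.inr α, b) (.inl i, a) := by
      intro α b i a
      simp only [cover_adj_iff, hc]
    refine Subtype.ext (SimpleGraph.ext ?_)
    funext u w
    obtain ⟨i | α, a⟩ := u <;> obtain ⟨j | β, b⟩ := w
    · exact propext ⟨fun h => (H.2.map_adj h).elim, fun h => (H'.2.map_adj h).elim⟩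
    · rw [SimpleGraph.adj_comm, hadj, SimpleGraph.adj_comm]
    · rw [hadj]
    · exact propext ⟨fun h => (H.2.map_adj h).elim, fun h => (H'.2.map_adj h).elim⟩
  · intro σ
    refine ⟨⟨G.permGraph σ, G.isGraphCover_permGraph σ⟩, ?_⟩
    funext α i
    ext b : 1
    exact (G.copy_unique (⟨G.permGraph σ, G.isGraphCover_permGraph σ⟩ : KCover G.factorGraph k)
      (α, b) i (σ α i b) ⟨i.2, rfl⟩).symm

/-- Covers correspond to families of permutations, one for each edge of the factor graph. -/
def coverEquiv : KCover G.factorGraph k ≃ (∀ α, G.scope α → Equiv.Perm (Fin k)) :=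
  Equiv.ofBijective _ G.coverPerm_bijective

theorem card_kCover [Fintype V] [Fintype A] :
    Fintype.card (KCover G.factorGraph k) = ∏ α, ∏ _i : G.scope α, k.factorial := by
  classical
  rw [Fintype.card_congr G.coverEquiv, Fintype.card_pi]
  refine Finset.prod_congr rfl fun α _ => ?_
  rw [Fintype.card_pi]
  simp [Fintype.card_perm]

end CoverEquiv

/-! ### The average partition function as a sum over labellings -/

section Counts

/-- Labellings of all copies of the variables and of the factors. -/
abbrev Labelling (G : GraphicalModel V A) (k : ℕ) : Type _ :=
  (V → Fin k → Bool) × ((α : A) → Fin k → G.scope α → Bool)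

/-- Numbers of copies of the variables and of the factors that carry a given label. -/
abbrev Counts (G : GraphicalModel V A) : Type _ :=
  (V → Bool → ℕ) × ((α : A) → (G.scope α → Bool) → ℕ)

variable [DecidableEq V]

/-- The counts of a labelling. -/
def Labelling.counts {G : GraphicalModel V A} (ω : G.Labelling k) : G.Counts :=
  (fun i => valueCount (ω.1 i), fun α => valueCount (ω.2 α))

variable [Fintype V] [Fintype A]

/-- The contribution to the average partition function of a labelling with counts `t`. -/
def countWeight (k : ℕ) (t : G.Counts) : ℝ :=
  (∏ i, ∏ s, G.φ i s ^ t.1 i s) * ∏ α, ((∏ y, G.ψ α y ^ t.2 α y) *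
    ∏ i : G.scope α, if t.1 i = (fun s => ∑ y with y i = s, t.2 α y)
      then (multiCoeff k (t.1 i))⁻¹ else 0)

theorem Z_cover (H : KCover G.factorGraph k) :
    (G.cover H).Z = ∑ x : V → Fin k → Bool, (∏ i, ∏ a, G.φ i (x i a)) *
      ∏ α, ∏ b, G.ψ α fun i => x i (G.coverPerm H α i b) := by
  unfold Z
  rw [← (Equiv.curry V (Fin k) Bool).symm.sum_comp]
  refine Finset.sum_congr rfl fun x _ => ?_
  unfold f
  rw [Fintype.prod_prod_type, Fintype.prod_prod_type]
  rfl

/-- For fixed `x` the sum over covers factorizes over the factors `α`, since each edge has its own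
permutation. Dividing the number of suitable permutations of an edge, `∏ s, (c s)!`, by `k!` gives
the inverse multinomial coefficient. -/
theorem average_Z_cover [DecidableEq A] :
    (∑ H : KCover G.factorGraph k, (G.cover H).Z) / (Fintype.card (KCover G.factorGraph k) : ℝ) =
      ∑ ω : G.Labelling k, G.countWeight k ω.counts := by
  have h1 : ∑ H : KCover G.factorGraph k, (G.cover H).Z =
      ∑ x : V → Fin k → Bool, (∏ i, ∏ a, G.φ i (x i a)) *
        ∏ α, ∑ σ : G.scope α → Equiv.Perm (Fin k), ∏ b, G.ψ α fun i => x i (σ i b) := by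
    simp_rw [Z_cover]
    rw [Finset.sum_comm]
    refine Finset.sum_congr rfl fun x _ => ?_
    rw [← Finset.mul_sum, Finset.prod_univ_sum, Fintype.piFinset_univ, ← G.coverEquiv.sum_comp]
    rfl
  rw [h1, card_kCover, Finset.sum_div, Fintype.sum_prod_type]
  refine Finset.sum_congr rfl fun x _ => ?_
  unfold countWeight
  simp only [Labelling.counts, ← prod_comp_eq_prod_pow_valueCount]
  rw [← Finset.mul_sum, mul_div_assoc]
  congr 1
  push_cast
  rw [← Finset.prod_div_distrib]
  have h2 : ∀ α, (∑ σ : G.scope α → Equiv.Perm (Fin k), ∏ b, G.ψ α fun i => x i (σ i b)) /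
      ∏ _i : G.scope α, (k.factorial : ℝ) =
      ∑ y : Fin k → G.scope α → Bool, (∏ b, G.ψ α (y b)) * ∏ i : G.scope α,
        if valueCount (x i) = (fun s => ∑ z with z i = s, valueCount y z)
          then (multiCoeff k (valueCount (x i)))⁻¹ else 0 := by
    intro α
    rw [sum_perm_family (fun i : G.scope α => x i) (fun y => ∏ b, G.ψ α (y b)), Finset.sum_div]
    refine Finset.sum_congr rfl fun y _ => ?_
    rw [mul_div_assoc, ← Finset.prod_div_distrib]
    congr 1
    refine Finset.prod_congr rfl fun i _ => ?_
    have h3 : valueCount (fun b => y b i) = fun s => ∑ z with z i = s, valueCount y z :=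
      funext fun s => valueCount_comp (fun z : G.scope α → Bool => z i) y s
    rw [h3]
    split_ifs
    · rw [multiCoeff, inv_div]
    · simp
  simp_rw [h2]
  rw [Finset.prod_univ_sum, Fintype.piFinset_univ]
  rfl

theorem card_counts_eq [DecidableEq A] {t : G.Counts} (h1 : ∀ i, ∑ s, t.1 i s = k)
    (h2 : ∀ α, ∑ y, t.2 α y = k) :
    ((Finset.univ.filter fun ω : G.Labelling k => ω.counts = t).card : ℝ) =
      (∏ i, multiCoeff k (t.1 i)) * ∏ α, multiCoeff k (t.2 α) := by
  have h : (Finset.univ.filter fun ω : G.Labelling k => ω.counts = t) =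
      (Fintype.piFinset fun i => Finset.univ.filter fun x : Fin k → Bool => valueCount x = t.1 i) ×ˢ
      (Fintype.piFinset fun α => Finset.univ.filter fun y : Fin k → G.scope α → Bool =>
        valueCount y = t.2 α) := by
    ext ω
    simp [Labelling.counts, Prod.ext_iff, funext_iff]
  rw [h, Finset.card_product, Fintype.card_piFinset, Fintype.card_piFinset]
  push_cast
  congr 1
  · exact Finset.prod_congr rfl fun i _ => card_valueCount_eq (h1 i)
  · exact Finset.prod_congr rfl fun α _ => card_valueCount_eq (h2 α)

end Counts

end GraphicalModel

/-! ### The local polytope and attainment of the Bethe maximum -/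

theorem continuous_shannonEntropy {Y : Type*} [Fintype Y] :
    Continuous (shannonEntropy : (Y → ℝ) → ℝ) :=
  continuous_finsetSum _ fun y _ => Real.continuous_negMulLog.comp (continuous_apply y)

namespace GraphicalModel

variable {V A : Type*} {k : ℕ} (G : GraphicalModel V A)

/-- `τ` vanishes wherever the potentials do. -/
def IsSupported (τ : G.Pseudomarginal) : Prop :=
  (∀ i s, G.φ i s = 0 → τ.1 i s = 0) ∧ ∀ α y, G.ψ α y = 0 → τ.2 α y = 0

variable {G} in
theorem isClosed_isSupported : IsClosed {τ : G.Pseudomarginal | G.IsSupported τ} := by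
  simp only [IsSupported, Set.ofPred_and, Set.ofPred_forall]
  refine IsClosed.inter ?_ ?_
  · exact isClosed_iInter fun i => isClosed_iInter fun s => isClosed_iInter fun _ =>
      isClosed_eq (by fun_prop) (by fun_prop)
  · exact isClosed_iInter fun i => isClosed_iInter fun s => isClosed_iInter fun _ =>
      isClosed_eq (by fun_prop) (by fun_prop)

variable [DecidableEq V]

section Polytope

variable {G}

theorem localPolytope.sum_factor (hne : ∀ α, (G.scope α).Nonempty) {τ : G.Pseudomarginal}
    (hτ : τ ∈ G.localPolytope) (α : A) : ∑ y, τ.2 α y = 1 := by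
  obtain ⟨i, hi⟩ := hne α
  rw [← hτ.2.2.2 i, ← Finset.sum_fiberwise_of_maps_to (s := Finset.univ) (t := Finset.univ)
    (g := fun y : G.scope α → Bool => y ⟨i, hi⟩) (by simp)]
  exact Finset.sum_congr rfl fun s _ => hτ.2.2.1 α ⟨i, hi⟩ s

theorem localPolytope.le_node {τ : G.Pseudomarginal} (hτ : τ ∈ G.localPolytope) (α : A)
    (i : G.scope α) (y : G.scope α → Bool) : τ.2 α y ≤ τ.1 i (y i) := by
  rw [← hτ.2.2.1 α i (y i)]
  exact Finset.single_le_sum (f := fun y => τ.2 α y) (fun y _ => hτ.2.1 α y) (by simp)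

theorem localPolytope.node_le_one {τ : G.Pseudomarginal} (hτ : τ ∈ G.localPolytope) (i : V)
    (s : Bool) : τ.1 i s ≤ 1 := by
  rw [← hτ.2.2.2 i]
  exact Finset.single_le_sum (f := fun s => τ.1 i s) (fun s _ => hτ.1 i s) (Finset.mem_univ s)

variable (G) in
theorem isClosed_localPolytope : IsClosed G.localPolytope := by
  simp only [localPolytope, Set.ofPred_and, Set.ofPred_forall]
  refine IsClosed.inter ?_ (IsClosed.inter ?_ (IsClosed.inter ?_ ?_))
  · exact isClosed_iInter fun i => isClosed_iInter fun s =>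
      isClosed_le continuous_const (by fun_prop)
  · exact isClosed_iInter fun i => isClosed_iInter fun s =>
      isClosed_le continuous_const (by fun_prop)
  · exact isClosed_iInter fun α => isClosed_iInter fun i => isClosed_iInter fun s =>
      isClosed_eq (by fun_prop) (by fun_prop)
  · exact isClosed_iInter fun i => isClosed_eq (by fun_prop) (by fun_prop)

theorem isCompact_localPolytope (hne : ∀ α, (G.scope α).Nonempty) : IsCompact G.localPolytope := by
  refine (isCompact_Icc (a := (0 : G.Pseudomarginal)) (b := 1)).of_isClosed_subset
    G.isClosed_localPolytope fun τ hτ => ⟨⟨fun i s => hτ.1 i s, fun α y => hτ.2.1 α y⟩,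
      ⟨fun i s => localPolytope.node_le_one hτ i s, fun α y => ?_⟩⟩
  obtain ⟨i, hi⟩ := hne α
  exact (localPolytope.le_node hτ α ⟨i, hi⟩ y).trans (localPolytope.node_le_one hτ i _)

end Polytope

variable [Fintype V] [Fintype A]

/-- The Bethe entropy, as a signed sum of Shannon entropies. -/
def signedEntropy (τ : G.Pseudomarginal) : ℝ :=
  ∑ i, shannonEntropy (τ.1 i) +
    ∑ α, (shannonEntropy (τ.2 α) - ∑ i : G.scope α, shannonEntropy (τ.1 i))

/-- Splitting the logarithm of the quotient is legitimate where `τ_α(y) > 0`, since then every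
`τ_i(y_i) ≥ τ_α(y)` is positive. Marginalization turns the resulting cross terms into node
entropies. Unlike the quotient form, the signed sum is visibly continuous. -/
theorem betheEntropy_eq_signedEntropy {τ : G.Pseudomarginal} (hτ : τ ∈ G.localPolytope) :
    G.betheEntropy τ = G.signedEntropy τ := by
  unfold betheEntropy signedEntropy shannonEntropy
  rw [sub_eq_add_neg, ← Finset.sum_neg_distrib, ← Finset.sum_neg_distrib]
  congr 1
  · refine Finset.sum_congr rfl fun i _ => ?_
    rw [← Finset.sum_neg_distrib]
    exact Finset.sum_congr rfl fun s _ => by rw [Real.negMulLog, neg_mul]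
  · refine Finset.sum_congr rfl fun α _ => ?_
    have h1 : ∀ y : G.scope α → Bool,
        τ.2 α y * Real.log (τ.2 α y / ∏ i : G.scope α, τ.1 i (y i)) =
          τ.2 α y * Real.log (τ.2 α y) - ∑ i : G.scope α, τ.2 α y * Real.log (τ.1 i (y i)) := by
      intro y
      rcases (hτ.2.1 α y).eq_or_lt with h | h
      · simp [← h]
      · have h2 : ∀ i : G.scope α, τ.1 i (y i) ≠ 0 := fun i =>
          (h.trans_le (localPolytope.le_node hτ α i y)).ne'
        rw [Real.log_div h.ne' (Finset.prod_ne_zero_iff.2 fun i _ => h2 i),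
          Real.log_prod fun i _ => h2 i, mul_sub, Finset.mul_sum]
    have h2 : ∀ i : G.scope α, ∑ y : G.scope α → Bool, τ.2 α y * Real.log (τ.1 i (y i)) =
        ∑ s, τ.1 i s * Real.log (τ.1 i s) := by
      intro i
      rw [← Finset.sum_fiberwise_of_maps_to (s := Finset.univ) (t := Finset.univ)
        (g := fun y : G.scope α → Bool => y i) (by simp)]
      refine Finset.sum_congr rfl fun s _ => ?_
      rw [← hτ.2.2.1 α i s, Finset.sum_mul]
      refine Finset.sum_congr rfl fun y hy => ?_
      rw [(Finset.mem_filter.1 hy).2, hτ.2.2.1 α i s]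
    simp_rw [h1]
    rw [Finset.sum_sub_distrib, Finset.sum_comm]
    simp_rw [h2, Real.negMulLog, neg_mul, Finset.sum_neg_distrib]
    ring

/-- A continuous function which agrees with the Bethe approximation on those elements of
the local polytope that vanish wherever the potentials do. -/
def regularApprox (τ : G.Pseudomarginal) : ℝ :=
  (∏ i, ∏ s, (if G.φ i s = 0 then 1 else G.φ i s) ^ τ.1 i s) *
    (∏ α, ∏ y : G.scope α → Bool, (if G.ψ α y = 0 then 1 else G.ψ α y) ^ τ.2 α y) *
    Real.exp (G.signedEntropy τ)

theorem continuous_signedEntropy : Continuous G.signedEntropy := by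
  unfold signedEntropy
  refine Continuous.add (continuous_finsetSum _ fun i _ => ?_)
    (continuous_finsetSum _ fun α _ => Continuous.sub ?_ (continuous_finsetSum _ fun i _ => ?_))
  all_goals exact continuous_shannonEntropy.comp (by fun_prop)

theorem continuous_regularApprox : Continuous G.regularApprox := by
  unfold regularApprox
  refine (Continuous.mul ?_ ?_).mul (Real.continuous_exp.comp G.continuous_signedEntropy)
  · refine continuous_finsetProd _ fun i _ => continuous_finsetProd _ fun s _ => ?_
    exact (Real.continuous_const_rpow (by split_ifs with h <;> simp [h])).comp (by fun_prop)
  · refine continuous_finsetProd _ fun i _ => continuous_finsetProd _ fun s _ => ?_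
    -- Replacing a zero potential by `1` makes the base nonzero; `0 ^ t` would jump at `t = 0`.
    exact (Real.continuous_const_rpow (by split_ifs with h <;> simp [h])).comp (by fun_prop)

theorem betheApprox_nonneg (τ : G.Pseudomarginal) : 0 ≤ G.betheApprox τ :=
  mul_nonneg (mul_nonneg
    (Finset.prod_nonneg fun i _ => Finset.prod_nonneg fun s _ =>
      Real.rpow_nonneg (G.φ_nonneg i s) _)
    (Finset.prod_nonneg fun α _ => Finset.prod_nonneg fun y _ =>
      Real.rpow_nonneg (G.ψ_nonneg α y) _)) (Real.exp_pos _).le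

variable {G}

theorem betheApprox_eq_regularApprox {τ : G.Pseudomarginal} (hτ : τ ∈ G.localPolytope)
    (hs : G.IsSupported τ) : G.betheApprox τ = G.regularApprox τ := by
  unfold betheApprox regularApprox
  rw [betheEntropy_eq_signedEntropy G hτ]
  congr 2
  · refine Finset.prod_congr rfl fun i _ => Finset.prod_congr rfl fun s _ => ?_
    split_ifs with h
    · rw [hs.1 i s h]; simp
    · rfl
  · refine Finset.prod_congr rfl fun i _ => Finset.prod_congr rfl fun s _ => ?_
    split_ifs with h
    · rw [hs.2 i s h]; simp
    · rfl

theorem isSupported_of_betheApprox_ne_zero {τ : G.Pseudomarginal} (h : G.betheApprox τ ≠ 0) :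
    G.IsSupported τ := by
  have h1 := left_ne_zero_of_mul h
  constructor
  · intro i s hφ
    by_contra hτ
    have h2 := Finset.prod_ne_zero_iff.1 (Finset.prod_ne_zero_iff.1 (left_ne_zero_of_mul h1) i
      (Finset.mem_univ i)) s (Finset.mem_univ s)
    exact h2 (by rw [hφ, Real.zero_rpow hτ])
  · intro α y hψ
    by_contra hτ
    have h2 := Finset.prod_ne_zero_iff.1 (Finset.prod_ne_zero_iff.1 (right_ne_zero_of_mul h1) α
      (Finset.mem_univ α)) y (Finset.mem_univ y)
    exact h2 (by rw [hψ, Real.zero_rpow hτ])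

/-- The Bethe approximation attains its maximum on the local polytope. -/
theorem exists_isMaxOn_betheApprox (hne : ∀ α, (G.scope α).Nonempty)
    (hT : G.localPolytope.Nonempty) :
    ∃ τ ∈ G.localPolytope, ∀ τ' ∈ G.localPolytope, G.betheApprox τ' ≤ G.betheApprox τ := by
  -- Off the closed set of supported points the Bethe approximation is zero, so a maximum over the
  -- compact set of supported points is global; if there are none, every point is a maximizer.
  by_cases hF : (G.localPolytope ∩ {τ | G.IsSupported τ}).Nonempty
  · obtain ⟨τ, ⟨hτ, hs⟩, hmax⟩ := ((isCompact_localPolytope hne).inter_right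
      isClosed_isSupported).exists_isMaxOn hF G.continuous_regularApprox.continuousOn
    refine ⟨τ, hτ, fun τ' hτ' => ?_⟩
    by_cases h : G.betheApprox τ' = 0
    · rw [h]
      exact G.betheApprox_nonneg τ
    · have hs' := isSupported_of_betheApprox_ne_zero h
      rw [betheApprox_eq_regularApprox hτ hs, betheApprox_eq_regularApprox hτ' hs']
      exact hmax ⟨hτ', hs'⟩
  · obtain ⟨τ, hτ⟩ := hT
    refine ⟨τ, hτ, fun τ' hτ' => ?_⟩
    by_cases h : G.betheApprox τ' = 0
    · rw [h]
      exact G.betheApprox_nonneg τ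
    · exact (hF ⟨τ', hτ', isSupported_of_betheApprox_ne_zero h⟩).elim

end GraphicalModel

/-! ### Simultaneous approximation that preserves linear relations -/

section IntegerApproximation

/-- Multiplication by large integers, on a finitely generated group of real numbers, is
approximated up to bounded errors by homomorphisms to the integers. -/
theorem exists_linearMap_int_abs_sub_le (S : Submodule ℤ ℝ) [Module.Finite ℤ S] :
    ∃ L : ℕ → S →ₗ[ℤ] ℤ, ∀ x : S, ∃ C : ℝ, ∀ k : ℕ, |(L k x : ℝ) - k * x| ≤ C := by
  have : Module.Free ℤ S := Module.free_of_finite_type_torsion_free'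
  let b := Module.Free.chooseBasis ℤ S
  -- A finitely generated torsion-free group is free, so rounding is done on a basis and extended
  -- linearly; the error at `x` is at most the sum of the absolute coordinates of `x`.
  refine ⟨fun k => b.constr ℤ fun j => ⌊(k : ℝ) * (b j : ℝ)⌋, fun x =>
    ⟨∑ j, |(b.repr x j : ℝ)|, fun k => ?_⟩⟩
  have h1 : (x : ℝ) = ∑ j, (b.repr x j : ℝ) * (b j : ℝ) := by
    have h := congrArg S.subtype (b.sum_repr x)
    rw [map_sum] at h
    simpa using h.symm
  have h2 : ((b.constr ℤ (fun j => ⌊(k : ℝ) * (b j : ℝ)⌋) x : ℤ) : ℝ) =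
      ∑ j, (b.repr x j : ℝ) * (⌊(k : ℝ) * (b j : ℝ)⌋ : ℝ) := by
    rw [Module.Basis.constr_apply_fintype]
    simp [Module.Basis.equivFun_apply]
  rw [h1, h2, Finset.mul_sum, ← Finset.sum_sub_distrib]
  refine (Finset.abs_sum_le_sum_abs _ _).trans (Finset.sum_le_sum fun j _ => ?_)
  have h3 : |(⌊(k : ℝ) * (b j : ℝ)⌋ : ℝ) - k * b j| ≤ 1 := by
    rw [abs_le]
    constructor <;> linarith [Int.floor_le ((k : ℝ) * (b j : ℝ)),
      Int.lt_floor_add_one ((k : ℝ) * (b j : ℝ))]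
  calc _ = |(b.repr x j : ℝ)| * |(⌊(k : ℝ) * (b j : ℝ)⌋ : ℝ) - k * b j| := by
        rw [← abs_mul]; ring_nf
    _ ≤ _ := mul_le_of_le_one_right (abs_nonneg _) h3

/-- A nonnegative vector `v` is approximated by vectors with denominator `k`, for every large `k`,
which satisfy all relations between coordinate sums shared by `v` and an integral vector `e`. -/
theorem exists_nat_approximation {J : Type*} [Finite J] (v : J → ℝ) (hv : ∀ j, 0 ≤ v j)
    (e : J → ℕ) :
    ∃ N : ℕ → J → ℕ, (∀ j, v j = 0 → e j = 0 → ∀ k, N k j = 0) ∧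
      (∀ j, Tendsto (fun k : ℕ => (N k j : ℝ) / k) atTop (𝓝 (v j))) ∧
      ∀ᶠ k in atTop,
        (∀ P Q : Finset J, ∑ j ∈ P, v j = ∑ j ∈ Q, v j → ∑ j ∈ P, e j = ∑ j ∈ Q, e j →
          ∑ j ∈ P, N k j = ∑ j ∈ Q, N k j) ∧
        ∀ P : Finset J, ∑ j ∈ P, v j = 1 → ∑ j ∈ P, e j = 1 → ∑ j ∈ P, N k j = k := by
  let S : Submodule ℤ ℝ := Submodule.span ℤ (insert 1 (Set.range v))
  have : Module.Finite ℤ S :=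
    Module.Finite.span_of_finite ℤ ((Set.finite_range v).insert 1)
  obtain ⟨L, hL⟩ := exists_linearMap_int_abs_sub_le S
  let one : S := ⟨1, Submodule.subset_span (Set.mem_insert _ _)⟩
  let w : J → S := fun j => ⟨v j, Submodule.subset_span (Set.mem_insert_of_mem _ ⟨j, rfl⟩)⟩
  obtain ⟨C₀, hC₀⟩ := hL one
  obtain ⟨C, hC⟩ := exists_nat_ge C₀
  have hone : ∀ k, |(L k one : ℝ) - k| ≤ C := fun k => by
    simpa [one] using (hC₀ k).trans hC
  choose D hD using fun j => hL (w j)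
  -- The homomorphism preserves integral relations but may send `1` to something other than `k`.
  -- Multiples of `e` make up the defect `r k`; scaling by `k - C` instead of `k` ensures `r k ≥ 0`
  -- once `k ≥ C`, while keeping `r k` bounded.
  let r : ℕ → ℤ := fun k => k - L (k - C) one
  let z : ℕ → J → ℤ := fun k j => L (k - C) (w j) + r k * e j
  have hsub : ∀ k : ℕ, |((k - C : ℕ) : ℝ) - k| ≤ C := by
    intro k
    rcases le_total C k with h | h
    · simp [Nat.cast_sub h]
    · have : (k : ℝ) ≤ C := by exact_mod_cast h
      simpa [Nat.sub_eq_zero_of_le h] using this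
  have hr : ∀ k, |(r k : ℝ)| ≤ 2 * C := by
    intro k
    have h1 := abs_le.1 (hone (k - C))
    have h2 := abs_le.1 (hsub k)
    simp only [r]
    push_cast
    rw [abs_le]
    constructor <;> linarith [h1.1, h1.2, h2.1, h2.2]
  have hz : ∀ k j, |(z k j : ℝ) - k * v j| ≤ D j + C * v j + 2 * C * e j := by
    intro k j
    have h1 := hD j (k - C)
    have h2 : |(((k - C : ℕ) : ℝ) - k) * v j| ≤ C * v j := by
      rw [abs_mul, abs_of_nonneg (hv j)]
      exact mul_le_mul_of_nonneg_right (hsub k) (hv j)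
    have h3 : |(r k : ℝ) * e j| ≤ 2 * C * e j := by
      rw [abs_mul, Nat.abs_cast]
      exact mul_le_mul_of_nonneg_right (hr k) (Nat.cast_nonneg _)
    have h4 : (z k j : ℝ) - k * v j = ((L (k - C) (w j) : ℝ) - (k - C : ℕ) * (w j : ℝ)) +
        (((k - C : ℕ) : ℝ) - k) * v j + r k * e j := by
      simp only [z, w]
      push_cast
      ring
    rw [h4]
    exact (abs_add_three _ _ _).trans (by linarith)
  have hw0 : ∀ j, v j = 0 → w j = 0 := fun j h => Subtype.ext h
  have hpos : ∀ᶠ k in atTop, ∀ j, 0 ≤ z k j := by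
    rw [eventually_all]
    intro j
    -- If `v j = 0`, only `r k * e j` remains, whence the need for `r k ≥ 0`; if `v j > 0`, the
    -- growth of `k * v j` beats the bounded error.
    rcases (hv j).eq_or_lt with h | h
    · filter_upwards [eventually_ge_atTop C] with k hk
      have h1 := (abs_le.1 (hone (k - C))).2
      rw [Nat.cast_sub hk] at h1
      have h2 : (L (k - C) one : ℝ) ≤ (k : ℝ) := by linarith
      have h3 : L (k - C) one ≤ k := by exact_mod_cast h2
      simp only [z, hw0 j h.symm, map_zero, zero_add, r]
      exact mul_nonneg (by linarith) (Nat.cast_nonneg _)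
    · have h1 : Tendsto (fun k : ℕ => (k : ℝ) * v j) atTop atTop :=
        tendsto_natCast_atTop_atTop.atTop_mul_const h
      filter_upwards [h1.eventually_ge_atTop (D j + C * v j + 2 * C * e j)] with k hk
      have h2 := (abs_le.1 (hz k j)).1
      have h3 : (0 : ℝ) ≤ z k j := by linarith
      exact_mod_cast h3
  have hsum : ∀ k (P : Finset J), ∑ j ∈ P, z k j =
      L (k - C) (∑ j ∈ P, w j) + r k * (∑ j ∈ P, e j : ℕ) := by
    intro k P
    rw [map_sum]
    push_cast
    rw [Finset.mul_sum, ← Finset.sum_add_distrib]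
  refine ⟨fun k j => (z k j).toNat, ?_, ?_, ?_⟩
  · intro j hvj hej k
    simp [z, hw0 j hvj, hej]
  · intro j
    rw [tendsto_iff_norm_sub_tendsto_zero]
    refine squeeze_zero' (Eventually.of_forall fun _ => norm_nonneg _) ?_
      (tendsto_const_div_atTop_nhds_zero_nat (D j + C * v j + 2 * C * e j))
    filter_upwards [eventually_gt_atTop 0, hpos] with k hk hk'
    have hk0 : (0 : ℝ) < k := by exact_mod_cast hk
    have h1 : (((z k j).toNat : ℕ) : ℝ) = z k j := by
      exact_mod_cast Int.toNat_of_nonneg (hk' j)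
    have h2 : (z k j : ℝ) / k - v j = ((z k j : ℝ) - k * v j) / k := by field_simp
    rw [h1, h2, Real.norm_eq_abs, abs_div, abs_of_pos hk0]
    exact div_le_div_of_nonneg_right (hz k j) hk0.le
  · filter_upwards [hpos] with k hk
    have hcast : ∀ P : Finset J, ((∑ j ∈ P, (z k j).toNat : ℕ) : ℤ) = ∑ j ∈ P, z k j := by
      intro P
      push_cast
      exact Finset.sum_congr rfl fun j _ => Int.toNat_of_nonneg (hk j)
    constructor
    · intro P Q h1 h2
      have h3 : ∑ j ∈ P, w j = ∑ j ∈ Q, w j := Subtype.ext (by simpa [w] using h1)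
      zify
      rw [← Nat.cast_sum, ← Nat.cast_sum, hcast, hcast, hsum, hsum, h2, h3]
    · intro P h1 h2
      have h3 : ∑ j ∈ P, w j = one := Subtype.ext (by simpa [w, one] using h1)
      have h4 := hcast P
      rw [hsum, h2, h3] at h4
      simp only [r] at h4
      push_cast at h4
      zify
      linarith

end IntegerApproximation

/-! ### Log-supermodularity and consistent integer counts -/

theorem LogSupermodular.sup_ne_zero {ι : Type*} {f : (ι → Bool) → ℝ} (h : LogSupermodular f)
    (h0 : ∀ x, 0 ≤ f x) {x y : ι → Bool} (hx : f x ≠ 0) (hy : f y ≠ 0) : f (x ⊔ y) ≠ 0 := by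
  intro hxy
  have h1 := h x y
  rw [hxy, mul_zero] at h1
  exact (mul_pos ((h0 x).lt_of_ne' hx) ((h0 y).lt_of_ne' hy)).not_ge h1

namespace GraphicalModel

variable {V A : Type*} {k : ℕ} {G : GraphicalModel V A} [DecidableEq V]

/-- The counts `t` sum to `k` and are consistent between factors and variables. -/
structure IsCounts (k : ℕ) (t : G.Counts) : Prop where
  sum_node : ∀ i, ∑ s, t.1 i s = k
  marginal : ∀ (α : A) (i : G.scope α), t.1 i = fun s => ∑ y with y i = s, t.2 α y

/-- The pseudomarginals `t / k`. -/
def Counts.toMarginal (k : ℕ) (t : G.Counts) : G.Pseudomarginal :=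
  (fun i s => t.1 i s / k, fun α y => t.2 α y / k)

/-- The counts of a single configuration. -/
def pureCounts (G : GraphicalModel V A) (x : V → Bool) : G.Counts :=
  (fun i s => if x i = s then 1 else 0, fun α y => if (fun i : G.scope α => x i) = y then 1 else 0)

theorem isCounts_pureCounts (x : V → Bool) : IsCounts 1 (G.pureCounts x) where
  sum_node i := by simp [pureCounts]
  marginal α i := by
    funext s
    simp [pureCounts, eq_comm]

theorem IsCounts.toMarginal_mem {t : G.Counts} (ht : IsCounts k t) (hk : k ≠ 0) :
    t.toMarginal k ∈ G.localPolytope := by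
  have hk0 : (k : ℝ) ≠ 0 := by exact_mod_cast hk
  refine ⟨fun i s => ?_, fun α y => ?_, fun α i s => ?_, fun i => ?_⟩
  · exact div_nonneg (Nat.cast_nonneg _) (Nat.cast_nonneg _)
  · exact div_nonneg (Nat.cast_nonneg _) (Nat.cast_nonneg _)
  · have h := congrFun (ht.marginal α i) s
    simp only [Counts.toMarginal]
    rw [← Finset.sum_div, h]
    push_cast
    rfl
  · simp only [Counts.toMarginal]
    rw [← Finset.sum_div, div_eq_one_iff_eq hk0]
    exact_mod_cast ht.sum_node i

theorem localPolytope_nonempty : G.localPolytope.Nonempty :=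
  ⟨_, (isCounts_pureCounts fun _ => false).toMarginal_mem one_ne_zero⟩

theorem IsCounts.sum_factor (hne : ∀ α, (G.scope α).Nonempty) {t : G.Counts} (ht : IsCounts k t)
    (α : A) : ∑ y, t.2 α y = k := by
  obtain ⟨i, hi⟩ := hne α
  rw [← ht.sum_node i, ← Finset.sum_fiberwise_of_maps_to (s := Finset.univ) (t := Finset.univ)
    (g := fun y : G.scope α → Bool => y ⟨i, hi⟩) (by simp), ht.marginal α ⟨i, hi⟩]

/-- If a pseudomarginal vanishes wherever the potentials do, then some configuration has nonzero
potentials. -/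
theorem exists_configuration_ne_zero (hne : ∀ α, (G.scope α).Nonempty)
    (hG : G.IsLogSupermodular) {τ : G.Pseudomarginal} (hτ : τ ∈ G.localPolytope)
    (hs : G.IsSupported τ) :
    ∃ x : V → Bool, (∀ i, G.φ i (x i) ≠ 0) ∧ ∀ α, G.ψ α (fun i => x i) ≠ 0 := by
  classical
  -- The largest value that `τ` allows at each vertex. On a factor `α` this is the join of the
  -- support of `τ_α`, and log-supermodularity keeps `ψ_α` nonzero under joins.
  let x : V → Bool := fun i => decide (τ.1 i true ≠ 0)
  refine ⟨x, fun i hφ => ?_, fun α => ?_⟩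
  · have h1 := hs.1 i _ hφ
    by_cases h : τ.1 i true = 0
    · have h2 : x i = false := by simp [x, h]
      rw [h2] at h1
      have h3 := hτ.2.2.2 i
      simp [h, h1] at h3
    · have h2 : x i = true := by simp [x, h]
      rw [h2] at h1
      exact h h1
  · have hsum := localPolytope.sum_factor hne hτ α
    obtain ⟨y₀, -, hy₀⟩ := Finset.exists_ne_zero_of_sum_ne_zero (hsum.trans_ne one_ne_zero)
    let s := Finset.univ.filter fun y => τ.2 α y ≠ 0
    have hsne : s.Nonempty := ⟨y₀, by simp [s, hy₀]⟩
    have hx : (fun i : G.scope α => x i) = s.sup' hsne id := by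
      refine le_antisymm ?_ (Finset.sup'_le _ _ ?_)
      · intro i
        by_cases h : τ.1 i true = 0
        · have h1 : x i = false := by simp [x, h]
          simp only [h1]
          exact Bool.false_le _
        · rw [← hτ.2.2.1 α i true] at h
          obtain ⟨y, hy, hy0⟩ := Finset.exists_ne_zero_of_sum_ne_zero h
          have h1 : y ≤ s.sup' hsne id := Finset.le_sup' id (by simp [s, hy0])
          have h2 := h1 i
          rw [(Finset.mem_filter.1 hy).2] at h2
          exact le_trans (Bool.le_true _) h2
      · intro y hy i
        cases h : y i with
        | false => simp [h]
        | true =>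
          have h1 := localPolytope.le_node hτ α i y
          rw [h] at h1
          have h2 : 0 < τ.2 α y := (hτ.2.1 α y).lt_of_ne' (by simpa [s] using hy)
          have h3 : τ.1 i true ≠ 0 := (h2.trans_le h1).ne'
          simp [x, h3]
    rw [hx]
    refine Finset.sup'_induction (p := fun z => G.ψ α z ≠ 0) hsne id
      (fun a ha b hb => (hG α).sup_ne_zero (G.ψ_nonneg α) ha hb) ?_
    intro y hy h
    exact (Finset.mem_filter.1 hy).2 (hs.2 α y h)

/-- The constraints on counts are equalities between coordinate sums, shared by `τ` and the counts
of a single configuration. Choosing that configuration with nonzero potentials keeps the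
approximants zero wherever a potential vanishes. -/
theorem exists_counts_tendsto [Fintype V] [Fintype A] (hne : ∀ α, (G.scope α).Nonempty)
    (hG : G.IsLogSupermodular) {τ : G.Pseudomarginal} (hτ : τ ∈ G.localPolytope)
    (hs : G.IsSupported τ) :
    ∃ t : ℕ → G.Counts, (∀ᶠ k in atTop, IsCounts k (t k)) ∧
      (∀ k, G.IsSupported ((t k).toMarginal k)) ∧
      Tendsto (fun k => (t k).toMarginal k) atTop (𝓝 τ) := by
  obtain ⟨x, hφ, hψ⟩ := exists_configuration_ne_zero hne hG hτ hs
  have hx := G.isCounts_pureCounts x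
  obtain ⟨N, h0, hlim, hrel⟩ := exists_nat_approximation
    (J := (V × Bool) ⊕ (Σ α, (G.scope α → Bool)))
    (Sum.elim (fun p => τ.1 p.1 p.2) fun q => τ.2 q.1 q.2)
    (by
      rintro (p | q)
      · exact hτ.1 _ _
      · exact hτ.2.1 _ _)
    (Sum.elim (fun p => (G.pureCounts x).1 p.1 p.2) fun q => (G.pureCounts x).2 q.1 q.2)
  refine ⟨fun k => (fun i s => N k (.inl (i, s)), fun α y => N k (.inr ⟨α, y⟩)), ?_, ?_, ?_⟩
  · filter_upwards [hrel] with k hk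
    constructor
    · intro i
      have h := hk.2 (Finset.univ.map ⟨fun s => .inl (i, s), fun s s' h => by simpa using h⟩)
      rw [Finset.sum_map, Finset.sum_map] at h
      exact h (hτ.2.2.2 i) (hx.sum_node i)
    · intro α i
      funext s
      have h := hk.1 {.inl (i.1, s)} ((Finset.univ.filter fun y : G.scope α → Bool => y i = s).map
        ⟨fun y => .inr ⟨α, y⟩, fun s s' h => by simpa using h⟩)
      simp only [Finset.sum_map, Finset.sum_singleton] at h
      exact h (hτ.2.2.1 α i s).symm (congrFun (hx.marginal α i) s)
  · intro k
    constructor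
    · intro i s h
      have h1 := h0 (.inl (i, s)) (hs.1 i s h) (if_neg fun h' => hφ i (by rw [h', h])) k
      simp [Counts.toMarginal, h1]
    · intro α y h
      have h1 := h0 (.inr ⟨α, y⟩) (hs.2 α y h) (if_neg fun h' => hψ α (by rw [h', h])) k
      simp [Counts.toMarginal, h1]
  · refine Tendsto.prodMk_nhds ?_ ?_
    · exact tendsto_pi_nhds.2 fun i => tendsto_pi_nhds.2 fun s => hlim (.inl (i, s))
    · exact tendsto_pi_nhds.2 fun α => tendsto_pi_nhds.2 fun y => hlim (.inr ⟨α, y⟩)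

end GraphicalModel

/-! ### The weight of given counts compared with the Bethe approximation -/

namespace GraphicalModel

variable {V A : Type*} {k : ℕ} {G : GraphicalModel V A} [DecidableEq V] [Fintype V] [Fintype A]

theorem exp_mul_signedEntropy (k : ℕ) (τ : G.Pseudomarginal) :
    Real.exp (k * G.signedEntropy τ) =
      (∏ i, Real.exp (k * shannonEntropy (τ.1 i))) *
        ∏ α, (Real.exp (k * shannonEntropy (τ.2 α)) *
          ∏ i : G.scope α, (Real.exp (k * shannonEntropy (τ.1 i)))⁻¹) := by
  unfold signedEntropy
  rw [mul_add, Real.exp_add, Finset.mul_sum, Finset.mul_sum, Real.exp_sum, Real.exp_sum]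
  congr 1
  refine Finset.prod_congr rfl fun α _ => ?_
  rw [mul_sub, Real.exp_sub, Finset.mul_sum, Real.exp_sum, div_eq_mul_inv, Finset.prod_inv_distrib]

theorem betheApprox_toMarginal_pow {t : G.Counts} (ht : IsCounts k t) (hk : k ≠ 0) :
    G.betheApprox (t.toMarginal k) ^ k =
      (∏ i, ∏ s, G.φ i s ^ t.1 i s) * (∏ α, ∏ y, G.ψ α y ^ t.2 α y) *
        Real.exp (k * G.signedEntropy (t.toMarginal k)) := by
  have hk0 : (k : ℝ) ≠ 0 := by exact_mod_cast hk
  have h : ∀ (a : ℝ) (n : ℕ), 0 ≤ a → (a ^ ((n : ℝ) / k)) ^ k = a ^ n := by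
    intro a n ha
    rw [← Real.rpow_mul_natCast ha, div_mul_cancel₀ _ hk0, Real.rpow_natCast]
  rw [betheApprox, betheEntropy_eq_signedEntropy G (ht.toMarginal_mem hk), mul_pow, mul_pow,
    ← Real.exp_nat_mul]
  simp only [← Finset.prod_pow]
  congr 2
  · exact Finset.prod_congr rfl fun i _ => Finset.prod_congr rfl fun s _ => h _ _ (G.φ_nonneg i s)
  · exact Finset.prod_congr rfl fun i _ => Finset.prod_congr rfl fun s _ => h _ _ (G.ψ_nonneg i s)

variable (G) in
/-- The total contribution to the average partition function of the labellings with counts `t`. -/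
def typeWeight [DecidableEq A] (k : ℕ) (t : G.Counts) : ℝ :=
  (Finset.univ.filter fun ω : G.Labelling k => ω.counts = t).card • G.countWeight k t

theorem countWeight_nonneg (k : ℕ) (t : G.Counts) : 0 ≤ G.countWeight k t := by
  refine mul_nonneg (Finset.prod_nonneg fun i _ => Finset.prod_nonneg fun s _ =>
    pow_nonneg (G.φ_nonneg i s) _) (Finset.prod_nonneg fun α _ => mul_nonneg
    (Finset.prod_nonneg fun y _ => pow_nonneg (G.ψ_nonneg α y) _)
    (Finset.prod_nonneg fun i _ => ?_))
  split_ifs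
  · unfold multiCoeff
    positivity
  · exact le_rfl

theorem isCounts_counts (ω : G.Labelling k) (h : G.countWeight k ω.counts ≠ 0) :
    IsCounts k ω.counts where
  sum_node i := sum_valueCount (ω.1 i)
  marginal α i := by
    by_contra hne
    refine h (mul_eq_zero_of_right _ (Finset.prod_eq_zero (Finset.mem_univ α)
      (mul_eq_zero_of_right _ (Finset.prod_eq_zero (Finset.mem_univ i) (if_neg hne)))))

theorem typeWeight_eq [DecidableEq A] (hne : ∀ α, (G.scope α).Nonempty) {t : G.Counts}
    (ht : IsCounts k t) :
    G.typeWeight k t = (∏ i, ∏ s, G.φ i s ^ t.1 i s) * (∏ α, ∏ y, G.ψ α y ^ t.2 α y) *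
      ((∏ i, multiCoeff k (t.1 i)) * ∏ α, (multiCoeff k (t.2 α) *
        ∏ i : G.scope α, (multiCoeff k (t.1 i))⁻¹)) := by
  rw [typeWeight, nsmul_eq_mul, card_counts_eq G ht.sum_node (ht.sum_factor hne), countWeight]
  have h : ∀ α, (∏ i : G.scope α, if t.1 i = (fun s => ∑ y with y i = s, t.2 α y)
      then (multiCoeff k (t.1 i))⁻¹ else 0) = ∏ i : G.scope α, (multiCoeff k (t.1 i))⁻¹ := fun α =>
    Finset.prod_congr rfl fun i _ => if_pos (ht.marginal α i)
  simp_rw [h, Finset.prod_mul_distrib]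
  ring

variable (G) in
/-- An exponent that bounds the number of factorials in the weight of given counts. -/
def errorExponent : ℕ :=
  ∑ _i : V, (Fintype.card Bool + 1) + ∑ α, (Fintype.card (G.scope α → Bool) + 1 +
    ∑ _i : G.scope α, (Fintype.card Bool + 1))

/-- Each multinomial coefficient, inverted or not, contributes one entropy with the matching sign
and one polynomial error factor. -/
theorem agreeUpTo_entropy (hne : ∀ α, (G.scope α).Nonempty) {t : G.Counts}
    (ht : IsCounts k t) (hk : k ≠ 0) :
    AgreeUpTo ((3 * ((k : ℝ) + 1)) ^ G.errorExponent)
      ((∏ i, multiCoeff k (t.1 i)) * ∏ α, (multiCoeff k (t.2 α) *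
        ∏ i : G.scope α, (multiCoeff k (t.1 i))⁻¹))
      (Real.exp (k * G.signedEntropy (t.toMarginal k))) := by
  have h1 := fun i => agreeUpTo_multiCoeff hk (ht.sum_node i)
  have h2 := fun α => agreeUpTo_multiCoeff hk (ht.sum_factor hne α)
  have h := (AgreeUpTo.prod h1).mul
    (AgreeUpTo.prod fun α => (h2 α).mul (AgreeUpTo.prod fun i : G.scope α => (h1 i).inv))
  rw [exp_mul_signedEntropy, errorExponent]
  simp only [pow_add _ (∑ _i : V, (Fintype.card Bool + 1)), ← Finset.prod_pow_eq_pow_sum,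
    pow_add _ (Fintype.card (G.scope _ → Bool) + 1)]
  exact h

theorem betheApprox_pow_le [DecidableEq A] (hne : ∀ α, (G.scope α).Nonempty) {t : G.Counts}
    (ht : IsCounts k t) (hk : k ≠ 0) :
    G.betheApprox (t.toMarginal k) ^ k ≤
      (3 * ((k : ℝ) + 1)) ^ G.errorExponent * G.typeWeight k t := by
  rw [typeWeight_eq hne ht, betheApprox_toMarginal_pow ht hk, mul_left_comm]
  refine mul_le_mul_of_nonneg_left (agreeUpTo_entropy hne ht hk).ge (mul_nonneg ?_ ?_)
  · exact Finset.prod_nonneg fun i _ => Finset.prod_nonneg fun s _ => pow_nonneg (G.φ_nonneg i s) _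
  · exact Finset.prod_nonneg fun i _ => Finset.prod_nonneg fun s _ => pow_nonneg (G.ψ_nonneg i s) _

theorem typeWeight_le [DecidableEq A] (hne : ∀ α, (G.scope α).Nonempty) {t : G.Counts}
    (ht : IsCounts k t) (hk : k ≠ 0) :
    G.typeWeight k t ≤
      (3 * ((k : ℝ) + 1)) ^ G.errorExponent * G.betheApprox (t.toMarginal k) ^ k := by
  rw [typeWeight_eq hne ht, betheApprox_toMarginal_pow ht hk,
    mul_left_comm (_ ^ G.errorExponent)]
  refine mul_le_mul_of_nonneg_left (agreeUpTo_entropy hne ht hk).le (mul_nonneg ?_ ?_)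
  · exact Finset.prod_nonneg fun i _ => Finset.prod_nonneg fun s _ => pow_nonneg (G.φ_nonneg i s) _
  · exact Finset.prod_nonneg fun i _ => Finset.prod_nonneg fun s _ => pow_nonneg (G.ψ_nonneg i s) _

theorem sum_countWeight_eq [DecidableEq A] (k : ℕ) :
    ∑ ω : G.Labelling k, G.countWeight k ω.counts =
      ∑ t ∈ Finset.univ.image (Labelling.counts : G.Labelling k → G.Counts), G.typeWeight k t :=
  Finset.sum_comp (G.countWeight k) Labelling.counts

theorem typeWeight_le_sum_countWeight [DecidableEq A] (k : ℕ) (t : G.Counts) :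
    G.typeWeight k t ≤ ∑ ω : G.Labelling k, G.countWeight k ω.counts := by
  have h : G.typeWeight k t =
      ∑ ω : G.Labelling k with ω.counts = t, G.countWeight k ω.counts := by
    rw [typeWeight, ← Finset.sum_const]
    exact Finset.sum_congr rfl fun ω hω => by rw [(Finset.mem_filter.1 hω).2]
  rw [h]
  exact Finset.sum_le_sum_of_subset_of_nonneg (Finset.filter_subset _ _)
    fun ω _ _ => countWeight_nonneg k _

variable (G) in
/-- The number of coordinates of the counts. -/
def countsDim : ℕ :=
  ∑ _i : V, ∑ _s : Bool, 1 + ∑ α, ∑ _y : G.scope α → Bool, 1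

theorem card_image_counts_le [DecidableEq A] (k : ℕ) :
    (Finset.univ.image (Labelling.counts : G.Labelling k → G.Counts)).card ≤
      (k + 1) ^ G.countsDim := by
  have h : Finset.univ.image (Labelling.counts : G.Labelling k → G.Counts) ⊆
      (Fintype.piFinset fun _ => Fintype.piFinset fun _ => Finset.range (k + 1)) ×ˢ
        (Fintype.piFinset fun _ => Fintype.piFinset fun _ => Finset.range (k + 1)) := by
    intro t ht
    obtain ⟨ω, -, rfl⟩ := Finset.mem_image.1 ht
    simp only [Finset.mem_product, Fintype.mem_piFinset, Finset.mem_range, Nat.lt_succ_iff]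
    exact ⟨fun i s => valueCount_le _ _, fun α y => valueCount_le _ _⟩
  refine (Finset.card_le_card h).trans_eq ?_
  rw [Finset.card_product, countsDim, pow_add]
  simp only [Fintype.card_piFinset, Finset.card_range, ← Finset.prod_pow_eq_pow_sum, pow_one]

/-- Inconsistent counts contribute nothing; consistent ones are points of the local polytope after
division by `k`, and their number is polynomial in `k`. -/
theorem sum_countWeight_le [DecidableEq A] (hne : ∀ α, (G.scope α).Nonempty) (hk : k ≠ 0) {Z : ℝ}
    (hZ0 : 0 ≤ Z) (hZ : ∀ τ ∈ G.localPolytope, G.betheApprox τ ≤ Z) :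
    ∑ ω : G.Labelling k, G.countWeight k ω.counts ≤
      (3 * ((k : ℝ) + 1)) ^ (G.countsDim + G.errorExponent) * Z ^ k := by
  have hB : (0 : ℝ) ≤ 3 * ((k : ℝ) + 1) := by positivity
  rw [sum_countWeight_eq]
  calc _ ≤ ∑ t ∈ Finset.univ.image (Labelling.counts : G.Labelling k → G.Counts),
        (3 * ((k : ℝ) + 1)) ^ G.errorExponent * Z ^ k := by
        refine Finset.sum_le_sum fun t ht => ?_
        obtain ⟨ω, -, rfl⟩ := Finset.mem_image.1 ht
        by_cases h : G.countWeight k ω.counts = 0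
        · rw [typeWeight, h, smul_zero]
          positivity
        · have hc := isCounts_counts ω h
          refine (typeWeight_le hne hc hk).trans (mul_le_mul_of_nonneg_left ?_ (by positivity))
          exact pow_le_pow_left₀ (G.betheApprox_nonneg _) (hZ _ (hc.toMarginal_mem hk)) k
    _ ≤ (3 * ((k : ℝ) + 1)) ^ G.countsDim * ((3 * ((k : ℝ) + 1)) ^ G.errorExponent * Z ^ k) := by
        rw [Finset.sum_const, nsmul_eq_mul]
        refine mul_le_mul_of_nonneg_right ?_ (by positivity)
        refine (Nat.cast_le.2 (card_image_counts_le (G := G) k)).trans ?_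
        push_cast
        exact pow_le_pow_left₀ (by positivity)
          (by linarith [(Nat.cast_nonneg k : (0 : ℝ) ≤ k)]) _
    _ = _ := by ring

end GraphicalModel

/-! ### Passage to the limit -/

theorem tendsto_pow_rpow_one_div (D : ℕ) :
    Tendsto (fun k : ℕ => ((3 * ((k : ℝ) + 1)) ^ D) ^ (1 / (k : ℝ))) atTop (𝓝 1) := by
  have h1 := tendsto_rpow_div_mul_add D (1 / 3) (-1) (by norm_num)
  have h2 : Tendsto (fun k : ℕ => 3 * ((k : ℝ) + 1)) atTop atTop :=
    (tendsto_natCast_atTop_atTop.atTop_add tendsto_const_nhds).const_mul_atTop (by norm_num)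
  refine (h1.comp h2).congr fun k => ?_
  have h3 : (0 : ℝ) ≤ 3 * ((k : ℝ) + 1) := by positivity
  simp only [Function.comp_apply]
  rw [← Real.rpow_natCast, ← Real.rpow_mul h3]
  congr 1
  ring

end

theorem mainTheorem4 {V A : Type*} [Fintype V] [DecidableEq V] [Fintype A]
    (G : GraphicalModel V A) (hne : ∀ α, (G.scope α).Nonempty) (hG : G.IsLogSupermodular) :
    IsGreatest (G.betheApprox '' G.localPolytope) G.betheZ ∧
    Tendsto (fun k : ℕ =>
        ((∑ H : KCover G.factorGraph k, (G.cover H).Z) /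
          (Fintype.card (KCover G.factorGraph k) : ℝ)) ^ (1 / (k : ℝ)))
      atTop (𝓝 G.betheZ) := by
  classical
  obtain ⟨τ, hτ, hmax⟩ := GraphicalModel.exists_isMaxOn_betheApprox hne
    (GraphicalModel.localPolytope_nonempty (G := G))
  have hgreatest : IsGreatest (G.betheApprox '' G.localPolytope) (G.betheApprox τ) :=
    ⟨⟨τ, hτ, rfl⟩, by rintro _ ⟨τ', hτ', rfl⟩; exact hmax τ' hτ'⟩
  have hZ : G.betheZ = G.betheApprox τ := hgreatest.csSup_eq
  rw [hZ]
  refine ⟨hgreatest, ?_⟩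
  have h0 := G.betheApprox_nonneg τ
  simp_rw [GraphicalModel.average_Z_cover]
  have hroot : ∀ {k : ℕ} {a : ℝ}, k ≠ 0 → 0 ≤ a → (a ^ k) ^ (1 / (k : ℝ)) = a := by
    intro k a hk ha
    rw [one_div, Real.pow_rpow_inv_natCast ha hk]
  have hnonneg : ∀ k, 0 ≤ ∑ ω : G.Labelling k, G.countWeight k ω.counts := fun k =>
    Finset.sum_nonneg fun ω _ => GraphicalModel.countWeight_nonneg k _
  have hupper : Tendsto (fun k : ℕ => ((3 * ((k : ℝ) + 1)) ^
      (G.countsDim + G.errorExponent)) ^ (1 / (k : ℝ)) * G.betheApprox τ) atTop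
      (𝓝 (G.betheApprox τ)) := by
    simpa using (tendsto_pow_rpow_one_div _).mul_const (G.betheApprox τ)
  have hle : ∀ᶠ k : ℕ in atTop,
      (∑ ω : G.Labelling k, G.countWeight k ω.counts) ^ (1 / (k : ℝ)) ≤
        ((3 * ((k : ℝ) + 1)) ^ (G.countsDim + G.errorExponent)) ^ (1 / (k : ℝ)) *
          G.betheApprox τ := by
    filter_upwards [eventually_ne_atTop 0] with k hk
    have h := Real.rpow_le_rpow (hnonneg k) (GraphicalModel.sum_countWeight_le hne hk h0 hmax)
      (show 0 ≤ 1 / (k : ℝ) by positivity)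
    rwa [Real.mul_rpow (by positivity) (by positivity), hroot hk h0] at h
  -- When the maximum is zero there may be no supported point to approximate, but the upper bound
  -- already forces the limit to be zero.
  rcases h0.eq_or_lt with hz | hpos
  · rw [← hz] at hupper hle ⊢
    exact tendsto_of_tendsto_of_tendsto_of_le_of_le' tendsto_const_nhds hupper
      (Eventually.of_forall fun k => Real.rpow_nonneg (hnonneg k) _) hle
  · have hs := GraphicalModel.isSupported_of_betheApprox_ne_zero hpos.ne'
    obtain ⟨t, ht, hts, hlim⟩ := GraphicalModel.exists_counts_tendsto hne hG hτ hs
    -- The limit is taken through `regularApprox`, which is continuous and agrees with the Bethe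
    -- approximation at `τ` and, for large `k`, at the approximating points, all of them being
    -- supported.
    have hlower : Tendsto (fun k : ℕ => G.regularApprox ((t k).toMarginal k) /
        ((3 * ((k : ℝ) + 1)) ^ G.errorExponent) ^ (1 / (k : ℝ))) atTop
        (𝓝 (G.betheApprox τ)) := by
      rw [GraphicalModel.betheApprox_eq_regularApprox hτ hs]
      have h := ((G.continuous_regularApprox.tendsto τ).comp hlim).div
        (tendsto_pow_rpow_one_div G.errorExponent) one_ne_zero
      rwa [div_one] at h
    refine tendsto_of_tendsto_of_tendsto_of_le_of_le' hlower hupper ?_ hle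
    filter_upwards [ht, eventually_ne_atTop 0] with k hk hk0
    rw [div_le_iff₀ (by positivity), ← GraphicalModel.betheApprox_eq_regularApprox
      (hk.toMarginal_mem hk0) (hts k), mul_comm]
    have h1 := (GraphicalModel.betheApprox_pow_le hne hk hk0).trans
      (mul_le_mul_of_nonneg_left (GraphicalModel.typeWeight_le_sum_countWeight k (t k))
        (by positivity))
    have h2 := Real.rpow_le_rpow (pow_nonneg (G.betheApprox_nonneg _) k) h1
      (show 0 ≤ 1 / (k : ℝ) by positivity)
    rwa [Real.mul_rpow (by positivity) (hnonneg k), hroot hk0 (G.betheApprox_nonneg _)] at h2
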